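/- Let $J=\mathrm{diag}(1,-1,1)$, $[x,y]_J=y^*Jx$ on $\mathbb C^3$, and $A^\#=JA^*J$. For $A\in M_3(\mathbb C)$ let $$W^J(A)=W^J_+(A)\cup\big(-W^J_-(A)\big),\qquad W^J_\pm(A)=\{[Ax,x]_J:\ x\in\mathbb C^3,\ [x,x]_J=\pm1\},$$ and let $C^J(A)\subset\mathbb C\cong\mathbb R^2$ be the boundary generating curve of $W^J(A)$, i.e. the real affine part of the algebraic curve whose equation in homogeneous line coordinates $(u,v,w)$ (standing for the line $ux+vy+w=0$) is $$\det\Big(u\,\tfrac{A+A^\#}{2}+v\,\tfrac{A-A^\#}{2i}+w\,I_3\Big)=0.$$ Let $a\in\mathbb R$, $b_1,b_2,c_1,c_2\in\mathbb C$, $$A=\begin{pmatrix}a&b_1&0\\ c_1&-a&b_2\\ 0&c_2&a\end{pmatrix},\qquad \Delta=a^2+b_1c_1+b_2c_2 .$$ Then $W^J(A)$ is the (closed) hyperbolic disc bounded by a nondegenerate hyperbola $\mathcal H$ (the union of the two closed convex regions bounded by the branches of $\mathcal H$) with foci at $\pm\Delta^{1/2}$ and non-transverse axis of length $$\left(2|\Delta|-2a^2+|b_1|^2+|b_2|^2+|c_1|^2+|c_2|^2\right)^{1/2}$$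 if and only if $$a^2-2|\Delta|<\mathrm{Tr}(A^\#A)<a^2+2|\Delta|.$$ In this case, $C^J(A)$ is the union of the hyperbola $\mathcal H$ and the point $a$. -/

import Mathlib

open scoped Matrix

noncomputable section

namespace KreinRange

/-! ### Indefinite inner product and Krein space numerical range -/

section Krein

variable {n : Type*} [Fintype n]

/-- The indefinite inner product `[x, y]_J = y* J x` on `ℂⁿ`. -/
def ip (J : Matrix n n ℂ) (x y : n → ℂ) : ℂ := star y ⬝ᵥ (J *ᵥ x)

/-- `W₊ᴶ(A) = {[Ax, x]_J : [x, x]_J = 1}`. -/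
def rangePos (J A : Matrix n n ℂ) : Set ℂ :=
  {z | ∃ x : n → ℂ, ip J x x = 1 ∧ z = ip J (A *ᵥ x) x}

/-- `W₋ᴶ(A) = {[Ax, x]_J : [x, x]_J = -1}`. -/
def rangeNeg (J A : Matrix n n ℂ) : Set ℂ :=
  {z | ∃ x : n → ℂ, ip J x x = -1 ∧ z = ip J (A *ᵥ x) x}

/-- The Krein space numerical range `Wᴶ(A) = -W₋ᴶ(A) ∪ W₊ᴶ(A)`. -/
def numRange (J A : Matrix n n ℂ) : Set ℂ :=
  {z | -z ∈ rangeNeg J A} ∪ rangePos J A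

/-- The `J`-adjoint `A^# = J A* J`. -/
def adj (J A : Matrix n n ℂ) : Matrix n n ℂ := J * Aᴴ * J

/-- `Reᴶ(A) = (A + A^#) / 2`. -/
def reJ (J A : Matrix n n ℂ) : Matrix n n ℂ := (2 : ℂ)⁻¹ • (A + adj J A)

/-- `Imᴶ(A) = (A - A^#) / (2i)`. -/
def imJ (J A : Matrix n n ℂ) : Matrix n n ℂ := (2 * Complex.I)⁻¹ • (A - adj J A)

end Krein

/-! ### Dual curves and the boundary generating curve -/

/-- The gradient of a polynomial in three variables, at a point of `ℂ³`. -/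
def grad (G : MvPolynomial (Fin 3) ℂ) (p : Fin 3 → ℂ) : Fin 3 → ℂ :=
  fun i => MvPolynomial.eval p (MvPolynomial.pderiv i G)

/-- Homogeneous coordinate vectors of the tangent lines to the curve `F = 0` in the projective
plane: the gradients, at their smooth points, of the irreducible factors of `F`.  (Replacing a
factor by a nonzero multiple of it shows that this set is stable under nonzero scalars. The tangent
line to a linear factor is that line itself.) -/
def tangentVectors (F : MvPolynomial (Fin 3) ℂ) : Set (Fin 3 → ℂ) :=
  {y | ∃ (G : MvPolynomial (Fin 3) ℂ) (p : Fin 3 → ℂ), Irreducible G ∧ G ∣ F ∧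
    p ≠ 0 ∧ MvPolynomial.eval p G = 0 ∧ grad G p ≠ 0 ∧ y = grad G p}

/-- The affine cone over the dual of the projective plane curve `F = 0`: the Zariski closure of the
set of tangent lines at smooth points. For reducible `F` it is the union of the duals of the
irreducible components, the dual of a line being a single point. -/
def dualCone (F : MvPolynomial (Fin 3) ℂ) : Set (Fin 3 → ℂ) :=
  {y | ∀ P : MvPolynomial (Fin 3) ℂ,
    (∀ s ∈ tangentVectors F, MvPolynomial.eval s P = 0) → MvPolynomial.eval y P = 0}

section Curve

variable {n : Type*} [Fintype n] [DecidableEq n]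

/-- The form `det (u Reᴶ(A) + v Imᴶ(A) + w I)` in the line coordinates
`u = X 0`, `v = X 1`, `w = X 2`. -/
def kippenhahn (J A : Matrix n n ℂ) : MvPolynomial (Fin 3) ℂ :=
  Matrix.det
    ((MvPolynomial.X 0 : MvPolynomial (Fin 3) ℂ) • (reJ J A).map MvPolynomial.C +
     (MvPolynomial.X 1 : MvPolynomial (Fin 3) ℂ) • (imJ J A).map MvPolynomial.C +
     (MvPolynomial.X 2 : MvPolynomial (Fin 3) ℂ) • (1 : Matrix n n (MvPolynomial (Fin 3) ℂ)))

/-- The boundary generating curve `Cᴶ(A)`: the real affine part of the curve whose equation in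
homogeneous line coordinates is `det (u Reᴶ(A) + v Imᴶ(A) + w I) = 0`, where `(u, v, w)` stands for
the line `u x + v y + w = 0`, and where the real plane is identified with `ℂ` by `z = x + i y`. -/
def boundaryCurve (J A : Matrix n n ℂ) : Set ℂ :=
  {z | ![(z.re : ℂ), (z.im : ℂ), 1] ∈ dualCone (kippenhahn J A)}

end Curve

/-! ### Hyperbolas -/

/-- A nondegenerate hyperbola in the plane `ℂ`, given by its foci and the length `2 * semi` of its
transverse axis, where `0 < 2 * semi < dist focus₁ focus₂`. -/
structure Hyperbola where
  focus₁ : ℂ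
  focus₂ : ℂ
  semi : ℝ
  semi_pos : 0 < semi
  semi_lt : 2 * semi < dist focus₁ focus₂

namespace Hyperbola

/-- The points of the hyperbola (both branches). -/
def curve (H : Hyperbola) : Set ℂ :=
  {z | |dist z H.focus₁ - dist z H.focus₂| = 2 * H.semi}

/-- The (closed) hyperbolic disc bounded by the hyperbola: the two convex regions bounded by its
branches, that is, those which contain the foci. -/
def disc (H : Hyperbola) : Set ℂ :=
  {z | 2 * H.semi ≤ |dist z H.focus₁ - dist z H.focus₂|}

/-- The length of the non-transverse axis: its square plus the square of the length of the
transverse axis is the square of the distance between the foci. -/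
def nonTransverseAxis (H : Hyperbola) : ℝ :=
  Real.sqrt (dist H.focus₁ H.focus₂ ^ 2 - (2 * H.semi) ^ 2)

end Hyperbola

/-! ### The matrices -/

/-- `J = diag(1, -1, 1)`. -/
def J3 : Matrix (Fin 3) (Fin 3) ℂ := Matrix.diagonal ![1, -1, 1]

/-- The tridiagonal matrix `T₃(c, a, b)` with main diagonal `(a, -a, a)`, first upper diagonal
`(b₁, b₂)` and first lower diagonal `(c₁, c₂)`. -/
def T3 (a : ℝ) (b₁ b₂ c₁ c₂ : ℂ) : Matrix (Fin 3) (Fin 3) ℂ :=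
  !![(a : ℂ), b₁, 0;
     c₁, -(a : ℂ), b₂;
     0, c₂, (a : ℂ)]

/-- The set `W` is the nondegenerate hyperbolic disc bounded by the hyperbola `H`, and `H` has foci
`δ`, `-δ` and non-transverse axis of length `ℓ`. -/
def IsHyperbolicDisc (W : Set ℂ) (H : Hyperbola) (δ : ℂ) (ℓ : ℝ) : Prop :=
  W = H.disc ∧ H.focus₁ = δ ∧ H.focus₂ = -δ ∧ H.nonTransverseAxis = ℓ

end KreinRange

end

open scoped Matrix

noncomputable section

namespace KreinRange

/-! ### Binary quadratic forms -/

/-! Put `m = 2a² - ‖b₁‖² - ‖b₂‖² - ‖c₁‖² - ‖c₂‖²`. The trace is `a² + m`, so the trace condition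
reads `|m| < 2‖Δ‖`. A hyperbola with the prescribed foci and axis has squared axes `2‖Δ‖ + m` and
`2‖Δ‖ - m`; nondegeneracy makes both positive, which gives necessity. Under this condition its disc
is the set `0 ≤ conic m Δ z` (`mem_disc_iff`).

For sufficiency, a vector with `[x, x]_J = ±1` contributes the point `a C + k` of the range, where
`C = ±‖x‖²` in the Euclidean norm. For fixed `C` the values `k` fill an elliptic disc whose squared
support function is `(C² - 1) / 4 * supportSq`. So the range is a union of elliptic discs over `|C|
≥ 1`. Every such point makes a binary form in the direction `u` nonnegative, and the discriminant
inequality is `0 ≤ conic m Δ z` (`conic_nonneg_of_mem_numRange`). Conversely,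
`exists_hyperbolic_parameter` finds a disc containing a given `z` with `0 ≤ conic m Δ z`, and
`exists_sphere_point` realises `z` by a vector.

The Kippenhahn form splits as `(a u + w)` times a nondegenerate quadric. The linear factor is dual
to the point `a`, the quadric to the conic (`boundaryCurve_T3`). -/

lemma binaryForm_nonneg {x y w : ℝ} (hx : 0 ≤ x) (hy : 0 ≤ y) (hw : w ^ 2 ≤ x * y) (s t : ℝ) :
    0 ≤ x * s ^ 2 + 2 * w * s * t + y * t ^ 2 := by
  rcases hx.eq_or_lt with rfl | hx
  · have : w = 0 := by
      have : w ^ 2 ≤ 0 := by simpa using hw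
      nlinarith [sq_nonneg w, pow_eq_zero_iff (n := 2) (a := w) two_ne_zero]
    subst this
    nlinarith [mul_nonneg hy (sq_nonneg t)]
  · have h : 0 ≤ x * (x * s ^ 2 + 2 * w * s * t + y * t ^ 2) := by
      nlinarith [sq_nonneg (x * s + w * t), mul_nonneg (sub_nonneg.2 hw) (sq_nonneg t)]
    exact nonneg_of_mul_nonneg_right h hx

lemma binaryForm_discrim {x y w : ℝ}
    (h : ∀ s t : ℝ, 0 ≤ x * s ^ 2 + 2 * w * s * t + y * t ^ 2) :
    0 ≤ x ∧ 0 ≤ y ∧ w ^ 2 ≤ x * y := by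
  have hx : 0 ≤ x := by simpa using h 1 0
  have hy : 0 ≤ y := by simpa using h 0 1
  refine ⟨hx, hy, ?_⟩
  -- At `(w, -x)` and `(y, -w)` the form takes the values `x (x y - w²)` and `y (x y - w²)`; `(1,
  -- -w)` settles the case `x = y = 0`.
  have h1 := h w (-x)
  have h2 := h y (-w)
  have h3 := h 1 (-w)
  have h4 := h (-w) 1
  rcases hx.eq_or_lt with rfl | hx
  · rcases hy.eq_or_lt with rfl | hy
    · nlinarith
    · nlinarith
  · nlinarith

/-- If a nonnegative binary form dominates `p² - q²` while `p²` minus it is indefinite, then it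
dominates one of the degenerate forms `(q - C p)² / (C² - 1)`. -/
lemma exists_tangent_square {A B D : ℝ} (hD : 0 ≤ D) (hAD : B ^ 2 ≤ A * D)
    (hlt : (A - 1) * D < B ^ 2) (hge : B ^ 2 ≤ (A - 1) * (D + 1)) :
    ∃ C S : ℝ, C ^ 2 = 1 + S ^ 2 ∧
      ∀ p q : ℝ, (q - C * p) ^ 2 ≤ S ^ 2 * (A * p ^ 2 + 2 * B * p * q + D * q ^ 2) := by
  have hA : 0 ≤ A - 1 := by
    by_contra! h
    nlinarith [sq_nonneg B]
  have hB : 0 < B ^ 2 := lt_of_le_of_lt (mul_nonneg hA hD) hlt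
  obtain ⟨M, hM⟩ : ∃ M, M = A + D := ⟨_, rfl⟩
  have hMpos : 0 < M := by linarith
  have hR1 : 1 ≤ M ^ 2 - 4 * B ^ 2 := by subst hM; nlinarith [sq_nonneg (A - 1 - D)]
  obtain ⟨R, hR⟩ : ∃ R, R = √(M ^ 2 - 4 * B ^ 2) := ⟨_, rfl⟩
  have hRsq : R ^ 2 = M ^ 2 - 4 * B ^ 2 := by rw [hR, Real.sq_sqrt (by linarith)]
  have hRge : 1 ≤ R := by rw [hR]; exact Real.one_le_sqrt.2 hR1
  have hRpos : 0 < R := by linarith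
  have hMR : R < M := by nlinarith
  -- With `S² = 1/τ`, `C = κ/τ` and `κ² = τ(1 + τ)`, the difference of the two forms has
  -- coefficients `A - 1 - τ`, `B + κ`, `D - τ`. Writing `2τ + 1 = cosh θ`, `2κ = sinh θ`, its
  -- determinant is greatest at `tanh θ = -2B/M`, which is the choice made here.
  obtain ⟨τ, hτ⟩ : ∃ τ, τ = (M / R - 1) / 2 := ⟨_, rfl⟩
  obtain ⟨κ, hκ⟩ : ∃ κ, κ = -B / R := ⟨_, rfl⟩
  have hτR : 2 * τ * R = M - R := by rw [hτ]; field_simp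
  have hκR : κ * R = -B := by rw [hκ]; field_simp
  have hτpos : 0 < τ := by
    have : 0 < 2 * τ * R := by linarith
    have := pos_of_mul_pos_left this hRpos.le
    linarith
  have hκτ : κ ^ 2 = τ * (1 + τ) := by
    have : R ^ 2 * κ ^ 2 = R ^ 2 * (τ * (1 + τ)) := by
      have e1 : R ^ 2 * κ ^ 2 = B ^ 2 := by linear_combination (κ * R - B) * hκR
      have e2 : R ^ 2 * (τ * (1 + τ)) = B ^ 2 := by
        linear_combination (1 / 4) * (2 * τ * R + M - R + 2 * R) * hτR - (1 / 4) * hRsq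
      rw [e1, e2]
    exact mul_left_cancel₀ (by positivity) this
  -- the discriminant of the difference
  have hX : 0 ≤ (A - 1) * D - B ^ 2 - τ * M - 2 * B * κ := by
    have e : R * ((A - 1) * D - B ^ 2 - τ * M - 2 * B * κ)
        = R * (((A - 1) * D - B ^ 2) + M / 2 - R / 2) := by
      linear_combination (-M / 2) * hτR - 2 * B * hκR + (1 / 2) * hRsq
    -- The factors are `(A - 1)(D + 1) - B²` and `A D - B²`. After squaring, `R ≤ 2((A - 1)D - B²) +
    -- M` says that their product is nonnegative.
    have hfac : 0 ≤ ((A - 1) * D - B ^ 2 + A - 1) * ((A - 1) * D - B ^ 2 + D) :=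
      mul_nonneg (by linarith) (by linarith)
    have : R ≤ 2 * ((A - 1) * D - B ^ 2) + M := by
      apply abs_le_of_sq_le_sq' _ _ |>.2
      · rw [hRsq, hM]; nlinarith
      · subst hM; linarith
    have := mul_left_cancel₀ hRpos.ne' e
    linarith
  have hsum : 0 ≤ (A - 1 - τ) + (D - τ) := by
    have h2 : R * (2 * τ + 1) = M := by linarith
    nlinarith
  have hdet : (B + κ) ^ 2 ≤ (A - 1 - τ) * (D - τ) := by subst hM; nlinarith
  have h1 : 0 ≤ A - 1 - τ := by
    by_contra! h
    nlinarith [sq_nonneg (B + κ)]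
  have h2 : 0 ≤ D - τ := by
    by_contra! h
    nlinarith [sq_nonneg (B + κ)]
  refine ⟨κ / τ, 1 / √τ, ?_, fun p q => ?_⟩
  · rw [div_pow, div_pow, hκτ, Real.sq_sqrt hτpos.le]
    field_simp
    ring
  · rw [div_pow, Real.sq_sqrt hτpos.le]
    have h := binaryForm_nonneg h1 h2 hdet p q
    have e : (q - κ / τ * p) ^ 2 = 1 ^ 2 / τ * (τ * q ^ 2 - 2 * κ * p * q + (1 + τ) * p ^ 2) := by
      have : (q - κ / τ * p) ^ 2 = q ^ 2 - 2 * (κ / τ) * p * q + κ ^ 2 / τ ^ 2 * p ^ 2 := by ring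
      rw [this, hκτ]
      field_simp
    rw [e]
    exact mul_le_mul_of_nonneg_left (by linarith) (by positivity)

/-- In the application `n₁, m, n₂` are the coefficients of `supportSq / 4`, `hdet` is `|m| < 2‖Δ‖`
for the `m` of `conic`, and `hK` is `0 ≤ conic` up to a factor 4. For `y ≠ 0` the substitution `p =
a s`, `q = x s + y t` is invertible and reduces to `exists_tangent_square`; for `y = 0` it
degenerates and `C` is `x / a` or `a / x`, whichever has modulus at least 1. -/
lemma exists_hyperbolic_parameter {a n₁ n₂ m x y : ℝ} (h₂ : 0 ≤ n₂)
    (hN : m ^ 2 ≤ n₁ * n₂) (hdet : (a ^ 2 - n₁) * (-n₂) - m ^ 2 < 0)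
    (hK : 0 ≤ (a ^ 2 - n₁) * (-n₂) - m ^ 2
      - (-n₂ * x ^ 2 + 2 * m * x * y + (a ^ 2 - n₁) * y ^ 2)) :
    ∃ C S : ℝ, C ^ 2 = 1 + S ^ 2 ∧ ∀ s t : ℝ,
      (x * s + y * t - C * (a * s)) ^ 2 ≤ S ^ 2 * (n₁ * s ^ 2 + 2 * m * s * t + n₂ * t ^ 2) := by
  have ha : a ≠ 0 := by
    rintro rfl
    nlinarith
  have ha2 : 0 < a ^ 2 := by positivity
  by_cases hy : y = 0
  · subst hy
    by_cases hx : a ^ 2 ≤ x ^ 2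
    · refine ⟨x / a, √((x / a) ^ 2 - 1), ?_, fun s t => ?_⟩
      · have : 1 ≤ (x / a) ^ 2 := by rw [div_pow]; exact (one_le_div ha2).2 hx
        rw [Real.sq_sqrt (by linarith)]; ring
      · have : x * s + 0 * t - x / a * (a * s) = 0 := by field_simp; ring
        rw [this, zero_pow two_ne_zero]
        have hn1 : 0 ≤ n₁ := by
          by_contra! h
          nlinarith [sq_nonneg m, mul_nonneg (neg_pos.2 h).le h₂]
        have := binaryForm_nonneg hn1 h₂ hN s t
        exact mul_nonneg (sq_nonneg _) this
    · push Not at hx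
      have hx0 : x ≠ 0 := by
        rintro rfl
        linarith
      have hx2 : 0 < x ^ 2 := by positivity
      refine ⟨a / x, √((a / x) ^ 2 - 1), ?_, fun s t => ?_⟩
      · have : 1 ≤ (a / x) ^ 2 := by rw [div_pow]; exact (one_le_div hx2).2 hx.le
        rw [Real.sq_sqrt (by linarith)]; ring
      · have h1 : 1 < (a / x) ^ 2 := by rw [div_pow]; exact (one_lt_div hx2).2 hx
        have e : (x * s + 0 * t - a / x * (a * s)) ^ 2
            = ((a / x) ^ 2 - 1) * ((a ^ 2 - x ^ 2) * s ^ 2) := by field_simp; ring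
        rw [e, Real.sq_sqrt (by linarith)]
        have hn2 : 0 < n₂ := by
          refine h₂.lt_of_ne ?_
          rintro rfl
          nlinarith
        have hd : m ^ 2 ≤ (n₁ - (a ^ 2 - x ^ 2)) * n₂ := by nlinarith
        have hd1 : 0 ≤ n₁ - (a ^ 2 - x ^ 2) :=
          nonneg_of_mul_nonneg_left ((sq_nonneg m).trans hd) hn2
        have := binaryForm_nonneg hd1 h₂ hd s t
        have h3 : 0 ≤ (a / x) ^ 2 - 1 := by linarith
        gcongr
        linarith
  · have hay : 0 < (a * y) ^ 2 := by positivity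
    obtain ⟨A, hA⟩ : ∃ A, A = (n₁ * y ^ 2 - 2 * m * x * y + n₂ * x ^ 2) / (a * y) ^ 2 := ⟨_, rfl⟩
    obtain ⟨B, hB⟩ : ∃ B, B = (m * y - n₂ * x) / (a * y ^ 2) := ⟨_, rfl⟩
    obtain ⟨D, hD⟩ : ∃ D, D = n₂ / y ^ 2 := ⟨_, rfl⟩
    have key : A * D - B ^ 2 = (n₁ * n₂ - m ^ 2) / (a * y) ^ 2 := by
      rw [hA, hB, hD]; field_simp; ring
    have key1 : (A - 1) * D - B ^ 2 = ((a ^ 2 - n₁) * (-n₂) - m ^ 2) / (a * y) ^ 2 := by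
      rw [hA, hB, hD]; field_simp; ring
    have key2 : (A - 1) * (D + 1) - B ^ 2 = ((a ^ 2 - n₁) * (-n₂) - m ^ 2
        - (-n₂ * x ^ 2 + 2 * m * x * y + (a ^ 2 - n₁) * y ^ 2)) / (a * y) ^ 2 := by
      rw [hA, hB, hD]; field_simp; ring
    have k : 0 ≤ (n₁ * n₂ - m ^ 2) / (a * y) ^ 2 := div_nonneg (by linarith) hay.le
    have k1 := div_neg_of_neg_of_pos hdet hay
    have k2 := div_nonneg hK hay.le
    obtain ⟨C, S, hCS, h⟩ := exists_tangent_square (A := A) (B := B) (D := D)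
      (by rw [hD]; positivity) (by linarith) (by linarith) (by linarith)
    refine ⟨C, S, hCS, fun s t => (h (a * s) (x * s + y * t)).trans_eq ?_⟩
    congr 1
    rw [hA, hB, hD]; field_simp; ring

end KreinRange

namespace KreinRange

open ComplexConjugate

/-! ### Elliptic discs as images of spheres -/

/-- A real linear map to the plane with nontrivial kernel maps the unit sphere onto the convex set
with the same support function. -/
lemma exists_norm_eq_one_map_eq {E : Type*} [NormedAddCommGroup E] [NormedSpace ℝ E]
    [FiniteDimensional ℝ E] (hE : 2 < Module.finrank ℝ E) (T : E →ₗ[ℝ] ℂ) (w : ℂ)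
    (h : ∀ (u : ℂ) (s : ℝ), (∀ x : E, ‖x‖ ≤ 1 → (conj u * T x).re ≤ s) → (conj u * w).re ≤ s) :
    ∃ x : E, ‖x‖ = 1 ∧ T x = w := by
  obtain ⟨x, hx, hxw⟩ : ∃ x : E, ‖x‖ ≤ 1 ∧ T x = w := by
    -- The image of the closed ball is compact and convex, so a missing point would be strictly
    -- separated from it.
    by_contra! hne
    have hc : IsCompact (T '' Metric.closedBall 0 1) :=
      (isCompact_closedBall _ _).image T.continuous_of_finiteDimensional
    have hconv : Convex ℝ (T '' Metric.closedBall 0 1) := (convex_closedBall _ _).linear_image T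
    obtain ⟨f, s, hs, hw⟩ := geometric_hahn_banach_closed_point hconv hc.isClosed
      (x := w) (by
        rintro ⟨x, hx, hxw⟩
        exact hne x (by simpa using hx) hxw)
    have hf : ∀ z : ℂ, f z = (conj (⟨f 1, f Complex.I⟩ : ℂ) * z).re := by
      intro z
      have hz : z = z.re • (1 : ℂ) + z.im • Complex.I := by
        simp [Complex.re_add_im]
      conv_lhs => rw [hz]
      rw [map_add, map_smul, map_smul]
      simp [Complex.mul_re]
      ring
    have := h ⟨f 1, f Complex.I⟩ s (fun x hx => by
      rw [← hf]
      exact (hs _ ⟨x, by simpa using hx, rfl⟩).le)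
    rw [← hf] at this
    linarith
  -- Moving along a kernel vector keeps the image fixed while the norm grows continuously past 1, so
  -- the sphere has the same image as the ball.
  obtain ⟨k, hk, hk0⟩ : ∃ k ∈ LinearMap.ker T, k ≠ 0 := by
    refine Submodule.exists_mem_ne_zero_of_ne_bot fun hbot => ?_
    have := LinearMap.finrank_le_finrank_of_injective (LinearMap.ker_eq_bot.1 hbot)
    rw [Complex.finrank_real_complex] at this
    omega
  have hkn : 0 < ‖k‖ := norm_pos_iff.2 hk0
  have hcont : Continuous fun t : ℝ => ‖x + t • k‖ := by fun_prop
  have h2 : 1 ≤ ‖x + (2 / ‖k‖) • k‖ := by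
    have e : ‖(2 / ‖k‖) • k‖ = 2 := by
      rw [norm_smul, Real.norm_of_nonneg (by positivity)]; field_simp
    have := norm_sub_le (x + (2 / ‖k‖) • k) x
    rw [add_sub_cancel_left, e] at this
    linarith
  obtain ⟨t, -, ht⟩ := intermediate_value_Icc (a := 0) (b := 2 / ‖k‖) (by positivity)
    hcont.continuousOn ⟨by simpa using hx, h2⟩
  refine ⟨x + t • k, ht, ?_⟩
  rw [map_add, map_smul, LinearMap.mem_ker.1 hk, smul_zero, add_zero, hxw]

/-- Four times the square of the support function of the elliptic disc attached to the off-diagonal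
entries of `T3 a b₁ b₂ c₁ c₂`. -/
def supportSq (b₁ b₂ c₁ c₂ u : ℂ) : ℝ :=
  ‖u * conj b₁ - conj u * c₁‖ ^ 2 + ‖u * conj c₂ - conj u * b₂‖ ^ 2

lemma supportSq_nonneg (b₁ b₂ c₁ c₂ u : ℂ) : 0 ≤ supportSq b₁ b₂ c₁ c₂ u := by
  unfold supportSq; positivity

lemma exists_sphere_point (b₁ b₂ c₁ c₂ w : ℂ) (ρ : ℝ)
    (h : ∀ u : ℂ, (conj u * w).re ^ 2 ≤ ρ ^ 2 * supportSq b₁ b₂ c₁ c₂ u) :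
    ∃ x y : ℂ, ‖x‖ ^ 2 + ‖y‖ ^ 2 = 1 ∧
      ρ * (b₁ * conj x + c₂ * conj y - c₁ * x - b₂ * y) = w := by
  let T : EuclideanSpace ℂ (Fin 2) →ₗ[ℝ] ℂ :=
    { toFun := fun x => ρ * (b₁ * conj (x 0) + c₂ * conj (x 1) - c₁ * x 0 - b₂ * x 1)
      map_add' := fun x y => by simp; ring
      map_smul' := fun r x => by simp; ring }
  have hT : ∀ x, T x = ρ * (b₁ * conj (x 0) + c₂ * conj (x 1) - c₁ * x 0 - b₂ * x 1) :=
    fun _ => rfl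
  have hfin : 2 < Module.finrank ℝ (EuclideanSpace ℂ (Fin 2)) := by
    rw [← Module.finrank_mul_finrank ℝ ℂ (EuclideanSpace ℂ (Fin 2))]
    simp
  obtain ⟨x, hx, hxw⟩ := exists_norm_eq_one_map_eq hfin T w (by
    intro u s hs
    have hs0 : 0 ≤ s := by simpa using hs 0 (by simp)
    obtain ⟨σ, hσ⟩ : ∃ σ, σ = supportSq b₁ b₂ c₁ c₂ u := ⟨_, rfl⟩
    have hu := h u
    rw [← hσ] at hu
    have hσ0 : 0 ≤ σ := hσ ▸ supportSq_nonneg b₁ b₂ c₁ c₂ u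
    suffices hle : ρ ^ 2 * σ ≤ s ^ 2 from abs_le_of_sq_le_sq' (hu.trans hle) hs0 |>.2
    rcases hσ0.eq_or_lt with h0 | hpos
    · rw [← h0]; nlinarith
    -- The functional is `x ↦ ρ Re(α x₀ + β x₁)` with `‖α‖² + ‖β‖² = σ`; it is tested at the unit
    -- vector along `(conj α, conj β)`. Both signs of `ε` are needed because `ρ` may be negative.
    have key : ∀ ε : ℝ, ε ^ 2 = 1 → ε * (ρ * √σ) ≤ s := by
      intro ε hε
      have hsq : √σ * √σ = σ := Real.mul_self_sqrt hσ0
      have hsp : 0 < √σ := Real.sqrt_pos.2 hpos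
      have hσ' := hσ
      simp only [supportSq, ← Complex.normSq_eq_norm_sq, Complex.normSq_apply] at hσ'
      have := hs (WithLp.toLp 2 ![((ε / √σ : ℝ) : ℂ) * conj (u * conj b₁ - conj u * c₁),
        ((ε / √σ : ℝ) : ℂ) * conj (u * conj c₂ - conj u * b₂)]) (by
          rw [← abs_of_nonneg (norm_nonneg _), ← sq_le_one_iff_abs_le_one,
            EuclideanSpace.norm_sq_eq]
          have : ∀ z : ℂ, ‖((ε / √σ : ℝ) : ℂ) * conj z‖ ^ 2 = ‖z‖ ^ 2 / σ := fun z => by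
            rw [norm_mul, Complex.norm_conj, Complex.norm_real, mul_pow, Real.norm_eq_abs, sq_abs,
              div_pow, hε, sq, hsq]
            ring
          simp only [Fin.sum_univ_two, Matrix.cons_val_zero, Matrix.cons_val_one, this]
          rw [← add_div, hσ, supportSq, div_self]
          rw [← supportSq, ← hσ]; exact hpos.ne')
      rw [hT] at this
      refine le_trans (le_of_eq ?_) this
      have e : ε * (ρ * √σ) = ε / √σ * ρ * σ := by
        rw [div_mul_eq_mul_div, div_mul_eq_mul_div, eq_div_iff hsp.ne']
        linear_combination ε * ρ * hsq
      rw [e]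
      generalize ε / √σ = q
      rw [hσ']
      simp
      ring
    have h1 := key 1 (by norm_num)
    have h2 := key (-1) (by norm_num)
    have hsq : √σ ^ 2 = σ := Real.sq_sqrt hσ0
    have : (ρ * √σ) ^ 2 ≤ s ^ 2 := sq_le_sq' (by linarith) (by linarith)
    rwa [mul_pow, hsq] at this)
  refine ⟨x 0, x 1, ?_, by rw [← hT, hxw]⟩
  have := EuclideanSpace.norm_sq_eq x
  rw [hx] at this
  simpa using this.symm

/-! ### The numerical range of `T3` -/

lemma ip_J3 (x : Fin 3 → ℂ) :
    ip J3 x x = ((‖x 0‖ ^ 2 - ‖x 1‖ ^ 2 + ‖x 2‖ ^ 2 : ℝ) : ℂ) := by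
  have h : ∀ z : ℂ, conj z * z = ((‖z‖ ^ 2 : ℝ) : ℂ) := fun z => by
    rw [mul_comm, Complex.mul_conj, Complex.normSq_eq_norm_sq]
  simp [ip, J3, dotProduct, Fin.sum_univ_three, Matrix.mulVec_diagonal, -Complex.ofReal_pow]
  have h0 := h (x 0)
  have h1 := h (x 1)
  have h2 := h (x 2)
  push_cast at h0 h1 h2
  rw [h0, h1, h2]
  push_cast
  ring

lemma ip_J3_T3 (a : ℝ) (b₁ b₂ c₁ c₂ : ℂ) (x : Fin 3 → ℂ) :
    ip J3 (T3 a b₁ b₂ c₁ c₂ *ᵥ x) x =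
      ((a * (‖x 0‖ ^ 2 + ‖x 1‖ ^ 2 + ‖x 2‖ ^ 2) : ℝ) : ℂ)
        + (x 1 * (b₁ * conj (x 0) + c₂ * conj (x 2)) - conj (x 1) * (c₁ * x 0 + b₂ * x 2)) := by
  have h : ∀ z : ℂ, ((‖z‖ : ℝ) : ℂ) ^ 2 = conj z * z := fun z => by
    rw [mul_comm, Complex.mul_conj, Complex.normSq_eq_norm_sq]; push_cast; ring
  push_cast
  rw [h, h, h]
  simp [ip, J3, T3, dotProduct, Fin.sum_univ_three, Matrix.mulVec]
  ring

end KreinRange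

/-! ### The conic bounding the range, and the two inclusions. -/

namespace KreinRange

open ComplexConjugate

/-- The quadratic polynomial whose zero set is the hyperbola with foci at the square roots of `Δ`
and transverse axis of length `√(m + 2 ‖Δ‖)`. -/
def conic (m : ℝ) (Δ z : ℂ) : ℝ :=
  m ^ 2 / 4 - ‖Δ‖ ^ 2 - m * ‖z‖ ^ 2 + 2 * (z ^ 2 * conj Δ).re

lemma conic_eq (m : ℝ) (Δ z : ℂ) :
    conic m Δ z = m ^ 2 / 4 - (Δ.re ^ 2 + Δ.im ^ 2) - m * (z.re ^ 2 + z.im ^ 2)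
      + 2 * ((z.re ^ 2 - z.im ^ 2) * Δ.re + 2 * z.re * z.im * Δ.im) := by
  simp only [conic, ← Complex.normSq_eq_norm_sq, Complex.normSq_apply]
  simp only [pow_two, Complex.mul_re, Complex.mul_im, Complex.conj_re, Complex.conj_im]
  ring

lemma conic_eq_sq_sub_sq (m : ℝ) (Δ z : ℂ) :
    conic m Δ z = (‖z‖ ^ 2 - m / 2) ^ 2 - ‖z ^ 2 - Δ‖ ^ 2 := by
  rw [conic_eq]
  simp only [← Complex.normSq_eq_norm_sq, Complex.normSq_apply]
  simp [pow_two]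
  ring

/-! ### Hyperbolas with given foci -/

section HyperbolaConic

variable {H : Hyperbola} {δ : ℂ} {m : ℝ}

lemma dist_sub_dist_sq (z δ : ℂ) :
    (dist z δ - dist z (-δ)) ^ 2 = 2 * (‖z‖ ^ 2 + ‖δ ^ 2‖) - 2 * ‖z ^ 2 - δ ^ 2‖ := by
  have h1 : ‖z ^ 2 - δ ^ 2‖ = dist z δ * dist z (-δ) := by
    rw [Complex.dist_eq, Complex.dist_eq, ← norm_mul]; congr 1; ring
  have h2 : dist z δ ^ 2 + dist z (-δ) ^ 2 = 2 * (‖z‖ ^ 2 + ‖δ ^ 2‖) := by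
    simp [Complex.dist_eq, ← Complex.normSq_eq_norm_sq, Complex.normSq_apply]
    ring
  rw [h1, ← h2]; ring

/-- Squaring loses nothing: if `‖z‖² - m/2` were negative, then `‖Δ‖ - ‖z‖² ≤ ‖z² - Δ‖ ≤ m/2 - ‖z‖²`
would contradict `m < 2‖Δ‖`. -/
lemma abs_lt_of_conic_nonneg {Δ z : ℂ} (hm : |m| < 2 * ‖Δ‖) (hz : 0 ≤ conic m Δ z) :
    ‖z ^ 2 - Δ‖ ≤ ‖z‖ ^ 2 - m / 2 := by
  rw [conic_eq_sq_sub_sq] at hz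
  have h : ‖z ^ 2 - Δ‖ ≤ |‖z‖ ^ 2 - m / 2| := by
    have := sq_le_sq.1 (sub_nonneg.1 hz)
    rwa [abs_of_nonneg (norm_nonneg _)] at this
  rcases abs_cases (‖z‖ ^ 2 - m / 2) with ⟨h1, -⟩ | ⟨h1, -⟩
  · rwa [h1] at h
  · rw [h1] at h
    have h3 : ‖Δ‖ - ‖z ^ 2‖ ≤ ‖z ^ 2 - Δ‖ := by
      rw [norm_sub_rev]; exact norm_sub_norm_le _ _
    rw [norm_pow] at h3
    linarith [(abs_lt.1 hm).2]

lemma mem_disc_iff (h₁ : H.focus₁ = δ) (h₂ : H.focus₂ = -δ) (hm : |m| < 2 * ‖δ ^ 2‖)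
    (hs : (2 * H.semi) ^ 2 = m + 2 * ‖δ ^ 2‖) (z : ℂ) :
    z ∈ H.disc ↔ 0 ≤ conic m (δ ^ 2) z := by
  have e : z ∈ H.disc ↔ ‖z ^ 2 - δ ^ 2‖ ≤ ‖z‖ ^ 2 - m / 2 := by
    have := dist_sub_dist_sq z δ
    rw [Hyperbola.disc, Set.mem_ofPred_eq, h₁, h₂]
    have hsp := H.semi_pos
    rw [← abs_of_pos (show 0 < 2 * H.semi by linarith), ← sq_le_sq, hs, this]
    constructor <;> intro h <;> linarith
  rw [e]
  refine ⟨fun h => ?_, abs_lt_of_conic_nonneg hm⟩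
  rw [conic_eq_sq_sub_sq, sub_nonneg]
  exact pow_le_pow_left₀ (norm_nonneg _) h 2

lemma mem_curve_iff (h₁ : H.focus₁ = δ) (h₂ : H.focus₂ = -δ) (hm : |m| < 2 * ‖δ ^ 2‖)
    (hs : (2 * H.semi) ^ 2 = m + 2 * ‖δ ^ 2‖) (z : ℂ) :
    z ∈ H.curve ↔ conic m (δ ^ 2) z = 0 := by
  have e : z ∈ H.curve ↔ ‖z ^ 2 - δ ^ 2‖ = ‖z‖ ^ 2 - m / 2 := by
    have := dist_sub_dist_sq z δ
    rw [Hyperbola.curve, Set.mem_ofPred_eq, h₁, h₂]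
    have hsp := H.semi_pos
    rw [← abs_of_pos (show 0 < 2 * H.semi by linarith), ← sq_eq_sq_iff_abs_eq_abs, hs, this]
    constructor <;> intro h <;> linarith
  rw [e]
  constructor
  · intro h
    rw [conic_eq_sq_sub_sq, h, sub_self]
  · intro h
    have h1 := abs_lt_of_conic_nonneg hm h.ge
    rw [conic_eq_sq_sub_sq, sub_eq_zero] at h
    exact ((sq_eq_sq₀ ((norm_nonneg _).trans h1) (norm_nonneg _)).1 h).symm

end HyperbolaConic

/-! ### The numerical range in terms of the conic -/

section Range

variable {a m : ℝ} {b₁ b₂ c₁ c₂ Δ : ℂ}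

lemma supportSq_eq (hm : m = 2 * a ^ 2 - (‖b₁‖ ^ 2 + ‖b₂‖ ^ 2 + ‖c₁‖ ^ 2 + ‖c₂‖ ^ 2))
    (hΔ : Δ = (a : ℂ) ^ 2 + b₁ * c₁ + b₂ * c₂) (s t : ℝ) :
    supportSq b₁ b₂ c₁ c₂ ⟨s, t⟩ = 4 * ((a ^ 2 - (m + 2 * Δ.re) / 4) * s ^ 2
      + 2 * (-Δ.im / 2) * s * t + (-(m - 2 * Δ.re) / 4) * t ^ 2) := by
  subst hm hΔ
  simp only [supportSq, ← Complex.normSq_eq_norm_sq, Complex.normSq_apply]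
  simp [pow_two]
  ring

lemma sq_le_add_of_sq_le {p k C Q s : ℝ} (hC : C ^ 2 = 1 + 4 * Q) (hQ : 0 ≤ Q) (hs : 0 ≤ s)
    (hk : k ^ 2 ≤ Q * s) : p ^ 2 ≤ (p * C + k) ^ 2 + s / 4 := by
  rcases hQ.eq_or_lt with rfl | hQ
  · have : k = 0 := by
      rw [zero_mul] at hk
      exact pow_eq_zero_iff two_ne_zero |>.1 (le_antisymm hk (sq_nonneg k))
    subst this
    rw [add_zero, mul_pow, hC]
    linarith
  · have h : 0 ≤ 4 * Q * ((p * C + k) ^ 2 + s / 4 - p ^ 2) := by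
      -- Completing the square: after multiplication by `4Q`, and with `Q s` bounded below by `k²`,
      -- the claim becomes the nonnegativity of this square.
      have e : 4 * Q * (p * C + k) ^ 2 + k ^ 2 - 4 * Q * p ^ 2 = (4 * Q * p + C * k) ^ 2 := by
        linear_combination (4 * Q * p ^ 2 - k ^ 2) * hC
      nlinarith [sq_nonneg (4 * Q * p + C * k)]
    have := nonneg_of_mul_nonneg_right h (by linarith)
    linarith

lemma cauchy_schwarz_support (b₁ b₂ c₁ c₂ u : ℂ) (x : Fin 3 → ℂ) :
    (conj u * (x 1 * (b₁ * conj (x 0) + c₂ * conj (x 2))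
      - conj (x 1) * (c₁ * x 0 + b₂ * x 2))).re ^ 2 ≤
    ((‖x 0‖ ^ 2 + ‖x 2‖ ^ 2) * ‖x 1‖ ^ 2) * supportSq b₁ b₂ c₁ c₂ u := by
  obtain ⟨α, hα⟩ : ∃ α, α = u * conj b₁ - conj u * c₁ := ⟨_, rfl⟩
  obtain ⟨β, hβ⟩ : ∃ β, β = u * conj c₂ - conj u * b₂ := ⟨_, rfl⟩
  have e : (conj u * (x 1 * (b₁ * conj (x 0) + c₂ * conj (x 2))
      - conj (x 1) * (c₁ * x 0 + b₂ * x 2))).re = (conj (x 1) * (x 0 * α + x 2 * β)).re := by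
    rw [hα, hβ]; simp; ring
  rw [e, supportSq, ← hα, ← hβ]
  have h1 : (conj (x 1) * (x 0 * α + x 2 * β)).re ^ 2 ≤ ‖x 1‖ ^ 2 * ‖x 0 * α + x 2 * β‖ ^ 2 := by
    have := Complex.abs_re_le_norm (conj (x 1) * (x 0 * α + x 2 * β))
    rw [norm_mul, Complex.norm_conj] at this
    rw [← mul_pow, ← sq_abs]
    exact pow_le_pow_left₀ (abs_nonneg _) this 2
  have h2 : ‖x 0 * α + x 2 * β‖ ^ 2 ≤ (‖x 0‖ ^ 2 + ‖x 2‖ ^ 2) * (‖α‖ ^ 2 + ‖β‖ ^ 2) := by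
    have := norm_add_le (x 0 * α) (x 2 * β)
    rw [norm_mul, norm_mul] at this
    refine (pow_le_pow_left₀ (norm_nonneg _) this 2).trans ?_
    nlinarith [sq_nonneg (‖x 0‖ * ‖β‖ - ‖x 2‖ * ‖α‖)]
  calc _ ≤ _ := h1
    _ ≤ ‖x 1‖ ^ 2 * ((‖x 0‖ ^ 2 + ‖x 2‖ ^ 2) * (‖α‖ ^ 2 + ‖β‖ ^ 2)) := by gcongr
    _ = _ := by ring

lemma sq_le_of_mem_numRange {z : ℂ} (hz : z ∈ numRange J3 (T3 a b₁ b₂ c₁ c₂)) (u : ℂ) :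
    (a * u.re) ^ 2 ≤ (conj u * z).re ^ 2 + supportSq b₁ b₂ c₁ c₂ u / 4 := by
  suffices key : ∀ x : Fin 3 → ℂ, (‖x 0‖ ^ 2 - ‖x 1‖ ^ 2 + ‖x 2‖ ^ 2) ^ 2 = 1 →
      (a * u.re) ^ 2 ≤ (conj u * ip J3 (T3 a b₁ b₂ c₁ c₂ *ᵥ x) x).re ^ 2
        + supportSq b₁ b₂ c₁ c₂ u / 4 by
    rcases hz with ⟨x, hx, hxz⟩ | ⟨x, hx, hxz⟩
    · rw [ip_J3] at hx
      have := key x (by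
        have hx' : ‖x 0‖ ^ 2 - ‖x 1‖ ^ 2 + ‖x 2‖ ^ 2 = -1 := by exact_mod_cast hx
        rw [hx']; norm_num)
      rw [← hxz, mul_neg, Complex.neg_re, neg_sq] at this
      exact this
    · rw [ip_J3] at hx
      have := key x (by
        have hx' : ‖x 0‖ ^ 2 - ‖x 1‖ ^ 2 + ‖x 2‖ ^ 2 = 1 := by exact_mod_cast hx
        rw [hx']; norm_num)
      rw [← hxz] at this
      exact this
  intro x hx
  have h := sq_le_add_of_sq_le (p := a * u.re) (C := ‖x 0‖ ^ 2 + ‖x 1‖ ^ 2 + ‖x 2‖ ^ 2)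
    (by linear_combination hx) (by positivity) (supportSq_nonneg b₁ b₂ c₁ c₂ u)
    (cauchy_schwarz_support b₁ b₂ c₁ c₂ u x)
  convert h using 3
  rw [ip_J3_T3, mul_add, Complex.add_re, Complex.re_mul_ofReal, Complex.conj_re]
  ring

lemma conic_nonneg_of_mem_numRange
    (hm : m = 2 * a ^ 2 - (‖b₁‖ ^ 2 + ‖b₂‖ ^ 2 + ‖c₁‖ ^ 2 + ‖c₂‖ ^ 2))
    (hΔ : Δ = (a : ℂ) ^ 2 + b₁ * c₁ + b₂ * c₂) {z : ℂ}
    (hz : z ∈ numRange J3 (T3 a b₁ b₂ c₁ c₂)) : 0 ≤ conic m Δ z := by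
  -- These are the coefficients of `4 (Re(conj u z))² + supportSq - 4 (a Re u)²` in `u = s + i t`;
  -- their determinant is `4 * conic m Δ z`.
  have h := binaryForm_discrim (x := 4 * z.re ^ 2 - m - 2 * Δ.re)
    (y := 4 * z.im ^ 2 - m + 2 * Δ.re) (w := 4 * z.re * z.im - 2 * Δ.im) (fun s t => by
      have := sq_le_of_mem_numRange hz ⟨s, t⟩
      rw [supportSq_eq hm hΔ] at this
      simp at this
      nlinarith)
  rw [conic_eq]
  linarith [h.2.2]

lemma exists_vector_of_support (r t : ℝ) {w : ℂ}
    (h : ∀ u : ℂ, (conj u * w).re ^ 2 ≤ (r * t) ^ 2 * supportSq b₁ b₂ c₁ c₂ u) :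
    ∃ x : Fin 3 → ℂ, ip J3 x x = ((r ^ 2 - t ^ 2 : ℝ) : ℂ) ∧
      ip J3 (T3 a b₁ b₂ c₁ c₂ *ᵥ x) x = ((a * (r ^ 2 + t ^ 2) : ℝ) : ℂ) + w := by
  obtain ⟨x, y, hxy, hw⟩ := exists_sphere_point b₁ b₂ c₁ c₂ w (r * t) h
  -- The outer coordinates have total squared norm `r²` and the middle one `t²`, so the off-diagonal
  -- part is the sphere map scaled by `r t`.
  refine ⟨![r * x, t, r * y], ?_, ?_⟩
  · rw [ip_J3]
    simp only [Matrix.cons_val, norm_mul, Complex.norm_real, mul_pow, Real.norm_eq_abs, sq_abs]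
    norm_cast
    linear_combination r ^ 2 * hxy
  · rw [ip_J3_T3]
    simp only [Matrix.cons_val, norm_mul, Complex.norm_real, mul_pow, Real.norm_eq_abs, sq_abs,
      map_mul, Complex.conj_ofReal]
    congr 1
    · norm_cast
      linear_combination a * r ^ 2 * hxy
    · rw [← hw]
      push_cast
      ring

lemma mem_numRange_of_conic_nonneg
    (hm : m = 2 * a ^ 2 - (‖b₁‖ ^ 2 + ‖b₂‖ ^ 2 + ‖c₁‖ ^ 2 + ‖c₂‖ ^ 2))
    (hΔ : Δ = (a : ℂ) ^ 2 + b₁ * c₁ + b₂ * c₂) (hmΔ : |m| < 2 * ‖Δ‖) {z : ℂ}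
    (hz : 0 ≤ conic m Δ z) : z ∈ numRange J3 (T3 a b₁ b₂ c₁ c₂) := by
  have hN := binaryForm_discrim (x := a ^ 2 - (m + 2 * Δ.re) / 4) (w := -Δ.im / 2)
    (y := -(m - 2 * Δ.re) / 4) (fun s t => by
      have := supportSq_nonneg b₁ b₂ c₁ c₂ ⟨s, t⟩
      rw [supportSq_eq hm hΔ] at this
      linarith)
  have hlt : m ^ 2 < 4 * (Δ.re ^ 2 + Δ.im ^ 2) := by
    have : m ^ 2 < (2 * ‖Δ‖) ^ 2 := by
      rw [sq_lt_sq, abs_of_nonneg (by positivity : (0:ℝ) ≤ 2 * ‖Δ‖)]; exact hmΔ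
    rw [mul_pow, ← Complex.normSq_eq_norm_sq, Complex.normSq_apply] at this
    linarith
  rw [conic_eq] at hz
  obtain ⟨C, S, hCS, h⟩ := exists_hyperbolic_parameter (a := a) (x := z.re) (y := z.im)
    hN.2.1 hN.2.2 (by linarith) (by linarith)
  have hw : ∀ u : ℂ, (conj u * (z - ((a * C : ℝ) : ℂ))).re ^ 2
      ≤ (C ^ 2 - 1) / 4 * supportSq b₁ b₂ c₁ c₂ u := by
    rintro ⟨s, t⟩
    rw [supportSq_eq hm hΔ, hCS]
    refine (le_of_eq ?_).trans ((h s t).trans_eq ?_)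
    · simp; ring
    · ring
  have hC1 : 1 ≤ C ^ 2 := by nlinarith [sq_nonneg S]
  -- The branch `1 ≤ C` comes from positive vectors, the branch `C ≤ -1` from negative ones. In
  -- both, `r² - t² = ±1`, `r² + t² = |C|` and `(r t)² = (C² - 1) / 4`.
  rcases le_abs.1 ((one_le_sq_iff_one_le_abs C).1 hC1) with hC | hC
  · right
    have hr := Real.sq_sqrt (show 0 ≤ (C + 1) / 2 by linarith)
    have ht := Real.sq_sqrt (show 0 ≤ (C - 1) / 2 by linarith)
    obtain ⟨x, hx, hxz⟩ := exists_vector_of_support (a := a) (b₁ := b₁) (b₂ := b₂) (c₁ := c₁)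
      (c₂ := c₂) (√((C + 1) / 2)) (√((C - 1) / 2)) (w := z - ((a * C : ℝ) : ℂ)) (fun u => by
        rw [mul_pow, hr, ht]
        refine (hw u).trans_eq ?_
        ring)
    rw [hr, ht] at hx hxz
    refine ⟨x, ?_, ?_⟩
    · rw [hx]; push_cast; ring
    · rw [hxz]; push_cast; ring
  · left
    have hr := Real.sq_sqrt (show 0 ≤ (-C - 1) / 2 by linarith)
    have ht := Real.sq_sqrt (show 0 ≤ (-C + 1) / 2 by linarith)
    obtain ⟨x, hx, hxz⟩ := exists_vector_of_support (a := a) (b₁ := b₁) (b₂ := b₂) (c₁ := c₁)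
      (c₂ := c₂) (√((-C - 1) / 2)) (√((-C + 1) / 2)) (w := -(z - ((a * C : ℝ) : ℂ))) (fun u => by
        rw [mul_pow, hr, ht, mul_neg, Complex.neg_re, neg_sq]
        refine (hw u).trans_eq ?_
        ring)
    rw [hr, ht] at hx hxz
    refine ⟨x, ?_, ?_⟩
    · rw [hx]; push_cast; ring
    · rw [hxz]; push_cast; ring

end Range

end KreinRange

namespace KreinRange

open MvPolynomial

/-! ### Conics in line coordinates and their duals -/

/-- The linear form `a u + w`. -/
def pointForm (a : ℂ) : MvPolynomial (Fin 3) ℂ := C a * X 0 + X 2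

/-- The quadratic form `w² - (d₁ u² + 2 e u v + d₂ v²)`. -/
def quadric (d₁ e d₂ : ℂ) : MvPolynomial (Fin 3) ℂ :=
  X 2 ^ 2 - (C d₁ * X 0 ^ 2 + 2 * C e * X 0 * X 1 + C d₂ * X 1 ^ 2)

/-- The form defining the dual of the conic `quadric d₁ e d₂ = 0`. -/
def dualQuadric (d₁ e d₂ : ℂ) : MvPolynomial (Fin 3) ℂ :=
  C (d₁ * d₂ - e ^ 2) * X 2 ^ 2 - (C d₂ * X 0 ^ 2 - 2 * C e * X 0 * X 1 + C d₁ * X 1 ^ 2)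

lemma pderiv_pderiv_eq_zero {G : MvPolynomial (Fin 3) ℂ} (hG : G.totalDegree ≤ 1) (i j : Fin 3) :
    pderiv i (pderiv j G) = 0 := by
  rw [G.as_sum, map_sum, map_sum]
  refine Finset.sum_eq_zero fun s hs => ?_
  have hdeg := (le_totalDegree hs).trans hG
  rw [Finsupp.sum_fintype _ _ (by simp), Fin.sum_univ_three] at hdeg
  rw [pderiv_monomial, pderiv_monomial, monomial_eq_zero]
  have : s j = 0 ∨ (s - Finsupp.single j 1 : Fin 3 →₀ ℕ) i = 0 := by
    rw [Finsupp.tsub_apply]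
    by_cases hij : j = i
    · subst hij
      rw [Finsupp.single_eq_same]
      fin_cases j <;> simp at * <;> omega
    · rw [Finsupp.single_eq_of_ne (by tauto)]
      fin_cases i <;> fin_cases j <;> simp at * <;> omega
  rcases this with h | h <;> simp [h]

lemma isUnit_of_totalDegree_eq_zero {G : MvPolynomial (Fin 3) ℂ} (hG : G ≠ 0)
    (h : G.totalDegree = 0) : IsUnit G := by
  rw [totalDegree_eq_zero_iff_eq_C] at h
  rw [h] at hG ⊢
  exact (isUnit_iff_ne_zero.2 fun h0 => hG (by rw [h0, C_0])).map C

lemma pderiv_eq_zero_of_isUnit {G : MvPolynomial (Fin 3) ℂ} (hG : IsUnit G) (i : Fin 3) :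
    pderiv i G = 0 := by
  obtain ⟨r, -, rfl⟩ := isUnit_iff_eq_C_of_isReduced.1 hG
  exact pderiv_C

lemma pderiv_pointForm (a : ℂ) :
    pderiv 0 (pointForm a) = C a ∧ pderiv 1 (pointForm a) = 0 ∧ pderiv 2 (pointForm a) = 1 := by
  refine ⟨?_, ?_, ?_⟩ <;> simp [pointForm, pderiv_X]

lemma pderiv_quadric (d₁ e d₂ : ℂ) :
    pderiv 0 (quadric d₁ e d₂) = -(2 * (C d₁ * X 0 + C e * X 1)) ∧
    pderiv 1 (quadric d₁ e d₂) = -(2 * (C e * X 0 + C d₂ * X 1)) ∧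
    pderiv 2 (quadric d₁ e d₂) = 2 * X 2 := by
  have h2 : (2 : MvPolynomial (Fin 3) ℂ) = C 2 := (map_ofNat C 2).symm
  refine ⟨?_, ?_, ?_⟩ <;> simp [quadric, pderiv_X, h2] <;> simp [← h2] <;> ring

lemma irreducible_pointForm (a : ℂ) : Irreducible (pointForm a) := by
  have hd := (pderiv_pointForm a).2.2
  have hdeg : (pointForm a).totalDegree ≤ 1 := by
    refine (totalDegree_add _ _).trans (max_le ((totalDegree_mul _ _).trans ?_) ?_) <;> simp
  constructor
  · intro h
    rw [pderiv_eq_zero_of_isUnit h] at hd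
    exact zero_ne_one hd
  · intro G H hGH
    have hne : pointForm a ≠ 0 := by
      intro h
      rw [h, map_zero] at hd
      exact zero_ne_one hd
    have hG : G ≠ 0 := by rintro rfl; simp [hne] at hGH
    have hH : H ≠ 0 := by rintro rfl; simp [hne] at hGH
    rw [hGH, totalDegree_mul_of_isDomain hG hH] at hdeg
    by_cases h : G.totalDegree = 0
    · exact .inl (isUnit_of_totalDegree_eq_zero hG h)
    · exact .inr (isUnit_of_totalDegree_eq_zero hH (by omega))

lemma irreducible_quadric {d₁ e d₂ : ℂ} (hdet : d₁ * d₂ - e ^ 2 ≠ 0) :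
    Irreducible (quadric d₁ e d₂) := by
  obtain ⟨q0, q1, q2⟩ := pderiv_quadric d₁ e d₂
  have hdeg : (quadric d₁ e d₂).totalDegree ≤ 2 := by
    have h2 : (2 : MvPolynomial (Fin 3) ℂ) = C 2 := (map_ofNat C 2).symm
    rw [quadric, h2]
    refine (totalDegree_sub _ _).trans (max_le (by simp)
      ((totalDegree_add _ _).trans (max_le ((totalDegree_add _ _).trans (max_le ?_ ?_)) ?_)))
    · exact (totalDegree_mul _ _).trans (by simp)
    · rw [← C_mul, mul_assoc]
      exact (totalDegree_mul _ _).trans (by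
        have := totalDegree_mul (X (R := ℂ) (0 : Fin 3)) (X 1)
        rw [totalDegree_X, totalDegree_X] at this
        rw [totalDegree_C]
        omega)
    · exact (totalDegree_mul _ _).trans (by simp)
  constructor
  · intro h
    rw [pderiv_eq_zero_of_isUnit h] at q2
    have := congrArg (eval ![0, 0, 1]) q2
    simp at this
  · intro G H hGH
    have hne : quadric d₁ e d₂ ≠ 0 := by
      intro h
      rw [h, map_zero] at q2
      have := congrArg (eval ![0, 0, 1]) q2
      simp at this
    have hG : G ≠ 0 := by rintro rfl; simp [hne] at hGH
    have hH : H ≠ 0 := by rintro rfl; simp [hne] at hGH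
    rw [hGH, totalDegree_mul_of_isDomain hG hH] at hdeg
    by_cases h : G.totalDegree = 0
    · exact .inl (isUnit_of_totalDegree_eq_zero hG h)
    by_cases h' : H.totalDegree = 0
    · exact .inr (isUnit_of_totalDegree_eq_zero hH h')
    exfalso
    -- Two factors of degree 1 have zero Hessians, so the Hessian of their product is `g kᵀ + k gᵀ`.
    -- The missing mixed terms with `w` force `g₀`, `g₁` proportional to `k₀`, `k₁`, hence a `(u,
    -- v)` block of rank at most one, against `hdet`.
    have hess : ∀ i j, eval 0 (pderiv i (pderiv j (quadric d₁ e d₂))) =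
        eval 0 (pderiv i G) * eval 0 (pderiv j H) + eval 0 (pderiv j G) * eval 0 (pderiv i H) := by
      intro i j
      rw [hGH, pderiv_mul, map_add, pderiv_mul, pderiv_mul,
        pderiv_pderiv_eq_zero (by omega : G.totalDegree ≤ 1),
        pderiv_pderiv_eq_zero (by omega : H.totalDegree ≤ 1)]
      simp
      ring
    have h2 : (2 : MvPolynomial (Fin 3) ℂ) = C 2 := (map_ofNat C 2).symm
    have h00 := hess 0 0
    have h01 := hess 0 1
    have h11 := hess 1 1
    have h02 := hess 0 2
    have h12 := hess 1 2
    have h22 := hess 2 2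
    rw [q0] at h00
    rw [q1] at h01 h11
    rw [q2] at h02 h12 h22
    simp [h2, pderiv_X] at h00 h01 h11 h02 h12 h22
    generalize constantCoeff (pderiv 0 G) = g0 at *
    generalize constantCoeff (pderiv 1 G) = g1 at *
    generalize constantCoeff (pderiv 2 G) = g2 at *
    generalize constantCoeff (pderiv 0 H) = k0 at *
    generalize constantCoeff (pderiv 1 H) = k1 at *
    generalize constantCoeff (pderiv 2 H) = k2 at *
    have e22 : g2 * k2 = 1 := by linear_combination (-1 / 2) * h22
    have e0 : g0 = -g2 ^ 2 * k0 := by linear_combination -g0 * e22 - g2 * h02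
    have e1 : g1 = -g2 ^ 2 * k1 := by linear_combination -g1 * e22 - g2 * h12
    subst e0 e1
    have f0 : d₁ = g2 ^ 2 * k0 ^ 2 := by linear_combination (-1 / 2) * h00
    have f1 : d₂ = g2 ^ 2 * k1 ^ 2 := by linear_combination (-1 / 2) * h11
    have f2 : e = g2 ^ 2 * k0 * k1 := by linear_combination (-1 / 2) * h01
    exact hdet (by rw [f0, f1, f2]; ring)

lemma grad_pointForm (a : ℂ) (p : Fin 3 → ℂ) : grad (pointForm a) p = ![a, 0, 1] := by
  obtain ⟨h0, h1, h2⟩ := pderiv_pointForm a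
  ext i
  fin_cases i <;> simp [grad, h0, h1, h2]

lemma grad_quadric (d₁ e d₂ : ℂ) (p : Fin 3 → ℂ) :
    grad (quadric d₁ e d₂) p =
      ![-(2 * (d₁ * p 0 + e * p 1)), -(2 * (e * p 0 + d₂ * p 1)), 2 * p 2] := by
  obtain ⟨h0, h1, h2⟩ := pderiv_quadric d₁ e d₂
  ext i
  fin_cases i <;> simp [grad, h0, h1, h2]

lemma eval_quadric (d₁ e d₂ : ℂ) (p : Fin 3 → ℂ) : eval p (quadric d₁ e d₂) =
    p 2 ^ 2 - (d₁ * p 0 ^ 2 + 2 * e * p 0 * p 1 + d₂ * p 1 ^ 2) := by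
  simp [quadric]

lemma eval_dualQuadric (d₁ e d₂ : ℂ) (p : Fin 3 → ℂ) : eval p (dualQuadric d₁ e d₂) =
    (d₁ * d₂ - e ^ 2) * p 2 ^ 2 - (d₂ * p 0 ^ 2 - 2 * e * p 0 * p 1 + d₁ * p 1 ^ 2) := by
  simp [dualQuadric]

lemma eq_mul_C_of_dvd {F G : MvPolynomial (Fin 3) ℂ} (hF : Irreducible F) (hG : Irreducible G)
    (h : G ∣ F) : ∃ r : ℂ, r ≠ 0 ∧ G = F * C r := by
  obtain ⟨v, hv⟩ := (hG.associated_of_dvd hF h).symm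
  obtain ⟨r, hr, hrv⟩ := isUnit_iff_eq_C_of_isReduced.1 v.isUnit
  exact ⟨r, hr.ne_zero, by rw [← hv, hrv]⟩

lemma grad_mul_C (F : MvPolynomial (Fin 3) ℂ) (r : ℂ) (p : Fin 3 → ℂ) :
    grad (F * C r) p = r • grad F p := by
  ext i
  simp [grad]

lemma tangentVectors_subset {a d₁ e d₂ : ℂ} (hdet : d₁ * d₂ - e ^ 2 ≠ 0) {y : Fin 3 → ℂ}
    (hy : y ∈ tangentVectors (pointForm a * quadric d₁ e d₂)) :
    (y 0 = a * y 2 ∧ y 1 = 0) ∨ eval y (dualQuadric d₁ e d₂) = 0 := by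
  obtain ⟨G, p, hG, hdvd, -, hGp, -, rfl⟩ := hy
  rcases hG.prime.dvd_or_dvd hdvd with h | h
  · obtain ⟨r, -, rfl⟩ := eq_mul_C_of_dvd (irreducible_pointForm a) hG h
    left
    rw [grad_mul_C, grad_pointForm]
    simp [mul_comm]
  · obtain ⟨r, hr, rfl⟩ := eq_mul_C_of_dvd (irreducible_quadric hdet) hG h
    right
    rw [map_mul, eval_C, mul_eq_zero, or_iff_left hr, eval_quadric] at hGp
    rw [grad_mul_C, grad_quadric, eval_dualQuadric]
    simp
    linear_combination 4 * r ^ 2 * (d₁ * d₂ - e ^ 2) * hGp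

lemma mem_dualCone_iff {a d₁ e d₂ : ℂ} (hdet : d₁ * d₂ - e ^ 2 ≠ 0) (x y : ℂ) :
    ![x, y, 1] ∈ dualCone (pointForm a * quadric d₁ e d₂) ↔
      (x = a ∧ y = 0) ∨ eval ![x, y, 1] (dualQuadric d₁ e d₂) = 0 := by
  constructor
  · intro h
    -- These two products vanish on all tangent vectors, hence on the closure. Together they cut out
    -- the union of the dual conic and the point.
    have h1 := h (dualQuadric d₁ e d₂ * (X 0 - C a * X 2)) fun s hs => by
      rcases tangentVectors_subset hdet hs with h | h
      · simp [h.1]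
      · simp [h]
    have h2 := h (dualQuadric d₁ e d₂ * X 1) fun s hs => by
      rcases tangentVectors_subset hdet hs with h | h
      · simp [h.2]
      · simp [h]
    rw [map_mul, mul_eq_zero] at h1 h2
    rcases h1 with h1 | h1
    · exact .inr h1
    rcases h2 with h2 | h2
    · exact .inr h2
    left
    simp at h1 h2
    exact ⟨sub_eq_zero.1 h1, h2⟩
  · intro h P hP
    -- Every claimed point is itself a tangent vector, so no limit is required.
    apply hP
    rcases h with ⟨rfl, rfl⟩ | h
    · refine ⟨pointForm x, ![1, 0, -x], irreducible_pointForm x, dvd_mul_right _ _, ?_, ?_, ?_,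
        (grad_pointForm _ _).symm⟩
      · intro h
        simpa using congrFun h 0
      · simp [pointForm]
      · rw [grad_pointForm]
        intro h
        simpa using congrFun h 2
    · obtain ⟨q, hq⟩ : ∃ q, q * (2 * (d₁ * d₂ - e ^ 2)) = 1 :=
        ⟨_, inv_mul_cancel₀ (mul_ne_zero two_ne_zero hdet)⟩
      -- The contact point is found by inverting the matrix of the quadric, with `q = 1 / (2 (d₁ d₂
      -- - e²))`.
      have hg : grad (quadric d₁ e d₂) ![-(d₂ * x - e * y) * q, -(d₁ * y - e * x) * q, 1 / 2] =
          ![x, y, 1] := by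
        rw [grad_quadric]
        ext i
        fin_cases i
        · simp; linear_combination x * hq
        · simp; linear_combination y * hq
        · simp
      refine ⟨quadric d₁ e d₂, _, irreducible_quadric hdet, dvd_mul_left _ _, ?_, ?_, ?_, hg.symm⟩
      · intro h
        simpa using congrFun h 2
      · rw [eval_dualQuadric] at h
        rw [eval_quadric]
        simp at h ⊢
        linear_combination q ^ 2 * (d₁ * d₂ - e ^ 2) * h
          - (1 / 4) * (q * (2 * (d₁ * d₂ - e ^ 2)) + 1) * hq
      · rw [hg]
        intro h
        simpa using congrFun h 2

/-! ### The boundary generating curve of `T3` -/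

open ComplexConjugate

lemma reJ_T3 (a : ℝ) (b₁ b₂ c₁ c₂ : ℂ) : reJ J3 (T3 a b₁ b₂ c₁ c₂) =
    !![(a : ℂ), (b₁ - conj c₁) / 2, 0; (c₁ - conj b₁) / 2, -(a : ℂ), (b₂ - conj c₂) / 2;
      0, (c₂ - conj b₂) / 2, (a : ℂ)] := by
  ext i j
  fin_cases i <;> fin_cases j <;>
    simp [reJ, adj, J3, T3, Matrix.mul_apply, Matrix.diagonal] <;> ring

lemma imJ_T3 (a : ℝ) (b₁ b₂ c₁ c₂ : ℂ) : imJ J3 (T3 a b₁ b₂ c₁ c₂) =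
    !![0, -(Complex.I / 2) * (b₁ + conj c₁), 0;
      -(Complex.I / 2) * (c₁ + conj b₁), 0, -(Complex.I / 2) * (b₂ + conj c₂);
      0, -(Complex.I / 2) * (c₂ + conj b₂), 0] := by
  ext i j
  fin_cases i <;> fin_cases j <;>
    simp [imJ, adj, J3, T3, Matrix.mul_apply, Matrix.diagonal] <;>
    first
    | ring1
    | exact .inl (by ring1)

/-- The first and third diagonal entries of the tridiagonal pencil both equal `a u + w`, which
therefore divides the determinant. -/
lemma det_pencil (a r₁ r₂ r₃ r₄ s₁ s₂ s₃ s₄ : ℂ) :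
    Matrix.det ((X 0 : MvPolynomial (Fin 3) ℂ) •
        (!![a, r₁, 0; r₂, -a, r₃; 0, r₄, a] : Matrix (Fin 3) (Fin 3) ℂ).map C +
      (X 1 : MvPolynomial (Fin 3) ℂ) •
        (!![0, s₁, 0; s₂, 0, s₃; 0, s₄, 0] : Matrix (Fin 3) (Fin 3) ℂ).map C +
      (X 2 : MvPolynomial (Fin 3) ℂ) • (1 : Matrix (Fin 3) (Fin 3) (MvPolynomial (Fin 3) ℂ))) =
    pointForm a * quadric (a ^ 2 + r₁ * r₂ + r₃ * r₄)
      ((r₁ * s₂ + s₁ * r₂ + r₃ * s₄ + s₃ * r₄) / 2) (s₁ * s₂ + s₃ * s₄) := by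
  have h2 : (2 : MvPolynomial (Fin 3) ℂ) * C ((r₁ * s₂ + s₁ * r₂ + r₃ * s₄ + s₃ * r₄) / 2) =
      C (r₁ * s₂ + s₁ * r₂ + r₃ * s₄ + s₃ * r₄) := by
    have h2 : (2 : MvPolynomial (Fin 3) ℂ) = C 2 := (map_ofNat C 2).symm
    rw [h2, ← C_mul]; congr 1; ring
  rw [quadric, h2, pointForm, Matrix.det_fin_three]
  simp
  ring

lemma kippenhahn_T3 {a m : ℝ} {b₁ b₂ c₁ c₂ Δ : ℂ}
    (hm : m = 2 * a ^ 2 - (‖b₁‖ ^ 2 + ‖b₂‖ ^ 2 + ‖c₁‖ ^ 2 + ‖c₂‖ ^ 2))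
    (hΔ : Δ = (a : ℂ) ^ 2 + b₁ * c₁ + b₂ * c₂) :
    kippenhahn J3 (T3 a b₁ b₂ c₁ c₂) = pointForm a *
      quadric (((m + 2 * Δ.re) / 4 : ℝ) : ℂ) ((Δ.im / 2 : ℝ) : ℂ)
        (((m - 2 * Δ.re) / 4 : ℝ) : ℂ) := by
  rw [kippenhahn, reJ_T3, imJ_T3, det_pencil]
  subst hm hΔ
  simp only [← Complex.normSq_eq_norm_sq, Complex.normSq_apply]
  congr 2 <;> apply Complex.ext <;> simp [pow_two] <;> ring

theorem boundaryCurve_T3 {a m : ℝ} {b₁ b₂ c₁ c₂ Δ : ℂ}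
    (hm : m = 2 * a ^ 2 - (‖b₁‖ ^ 2 + ‖b₂‖ ^ 2 + ‖c₁‖ ^ 2 + ‖c₂‖ ^ 2))
    (hΔ : Δ = (a : ℂ) ^ 2 + b₁ * c₁ + b₂ * c₂) (hmΔ : |m| < 2 * ‖Δ‖) :
    boundaryCurve J3 (T3 a b₁ b₂ c₁ c₂) = {z | conic m Δ z = 0} ∪ {(a : ℂ)} := by
  -- The quadric has determinant `(m² - 4‖Δ‖²) / 16`, so this makes it nondegenerate; its dual form
  -- at `(Re z, Im z, 1)` is `conic m Δ z / 4`.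
  have hlt : m ^ 2 < 4 * (Δ.re ^ 2 + Δ.im ^ 2) := by
    have : m ^ 2 < (2 * ‖Δ‖) ^ 2 := by
      rw [sq_lt_sq, abs_of_nonneg (by positivity : (0 : ℝ) ≤ 2 * ‖Δ‖)]; exact hmΔ
    rw [mul_pow, ← Complex.normSq_eq_norm_sq, Complex.normSq_apply] at this
    linarith
  ext z
  rw [boundaryCurve, Set.mem_ofPred_eq, kippenhahn_T3 hm hΔ, mem_dualCone_iff, or_comm,
    eval_dualQuadric]
  · refine or_congr ?_ ?_
    · rw [Set.mem_ofPred_eq, conic_eq]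
      simp only [Matrix.cons_val]
      norm_cast
      constructor <;> intro h <;> linarith
    · simp [Complex.ext_iff]
  · norm_cast
    intro h
    linarith

end KreinRange

namespace KreinRange

/-! ### The trace condition -/

lemma trace_adj_T3 (a : ℝ) (b₁ b₂ c₁ c₂ : ℂ) :
    (Matrix.trace (adj J3 (T3 a b₁ b₂ c₁ c₂) * T3 a b₁ b₂ c₁ c₂)).re =
      3 * a ^ 2 - (‖b₁‖ ^ 2 + ‖b₂‖ ^ 2 + ‖c₁‖ ^ 2 + ‖c₂‖ ^ 2) := by
  simp only [← Complex.normSq_eq_norm_sq, Complex.normSq_apply]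
  simp [adj, J3, T3, Matrix.trace, Fin.sum_univ_three, Matrix.mul_apply, Matrix.diagonal]
  ring

lemma Hyperbola.two_mul_semi_sq {H : Hyperbola} {δ : ℂ} {s : ℝ} (h₁ : H.focus₁ = δ)
    (h₂ : H.focus₂ = -δ) (h : H.nonTransverseAxis = √s) :
    0 < s ∧ (2 * H.semi) ^ 2 = 4 * ‖δ ^ 2‖ - s := by
  have hd : dist H.focus₁ H.focus₂ ^ 2 = 4 * ‖δ ^ 2‖ := by
    rw [h₁, h₂, Complex.dist_eq, show δ - -δ = 2 * δ by ring, norm_mul, norm_pow]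
    norm_num
    ring
  have hpos : 0 < dist H.focus₁ H.focus₂ ^ 2 - (2 * H.semi) ^ 2 := by
    have h1 := H.semi_lt
    have h2 := H.semi_pos
    nlinarith
  rw [Hyperbola.nonTransverseAxis] at h
  -- `Real.sqrt` is 0 on negative reals; the positive axis length excludes that default and allows
  -- the roots to be compared.
  have hs : 0 < s := by
    rw [← Real.sqrt_pos, ← h]
    exact Real.sqrt_pos.2 hpos
  rw [Real.sqrt_inj hpos.le hs.le] at h
  exact ⟨hs, by linarith⟩

lemma exists_hyperbola {δ : ℂ} {s : ℝ} (hs : 0 < s) (hlt : s < 4 * ‖δ ^ 2‖) :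
    ∃ H : Hyperbola, H.focus₁ = δ ∧ H.focus₂ = -δ ∧ H.nonTransverseAxis = √s := by
  have hd : dist δ (-δ) ^ 2 = 4 * ‖δ ^ 2‖ := by
    rw [Complex.dist_eq, show δ - -δ = 2 * δ by ring, norm_mul, norm_pow]
    norm_num
    ring
  have hr : (2 * (√(4 * ‖δ ^ 2‖ - s) / 2)) ^ 2 = 4 * ‖δ ^ 2‖ - s := by
    rw [mul_div_cancel₀ _ two_ne_zero, Real.sq_sqrt (by linarith)]
  refine ⟨⟨δ, -δ, √(4 * ‖δ ^ 2‖ - s) / 2, ?_, ?_⟩, rfl, rfl, ?_⟩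
  · have := Real.sqrt_pos.2 (sub_pos.2 hlt)
    linarith
  · refine lt_of_pow_lt_pow_left₀ 2 dist_nonneg ?_
    rw [hr, hd]
    linarith
  · change √(dist δ (-δ) ^ 2 - (2 * (√(4 * ‖δ ^ 2‖ - s) / 2)) ^ 2) = √s
    rw [hr, hd, sub_sub_cancel]

lemma numRange_T3_eq_disc {a m : ℝ} {b₁ b₂ c₁ c₂ δ : ℂ}
    (hm : m = 2 * a ^ 2 - (‖b₁‖ ^ 2 + ‖b₂‖ ^ 2 + ‖c₁‖ ^ 2 + ‖c₂‖ ^ 2))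
    (hδ : δ ^ 2 = (a : ℂ) ^ 2 + b₁ * c₁ + b₂ * c₂) (hmδ : |m| < 2 * ‖δ ^ 2‖) {H : Hyperbola}
    (h₁ : H.focus₁ = δ) (h₂ : H.focus₂ = -δ) (hs : (2 * H.semi) ^ 2 = m + 2 * ‖δ ^ 2‖) :
    numRange J3 (T3 a b₁ b₂ c₁ c₂) = H.disc := by
  ext z
  rw [mem_disc_iff h₁ h₂ hmδ hs]
  exact ⟨conic_nonneg_of_mem_numRange hm hδ, mem_numRange_of_conic_nonneg hm hδ hmδ⟩

end KreinRange

end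

/-! ### Assembly: the trace condition as `|m| < 2‖Δ‖`. -/

theorem theorem3p1 (a : ℝ) (b₁ b₂ c₁ c₂ Δ δ : ℂ)
    (hΔ : Δ = (a : ℂ) ^ 2 + b₁ * c₁ + b₂ * c₂)
    -- `δ` is any square root of `Δ`
    (hδ : δ ^ 2 = Δ)
    (A : Matrix (Fin 3) (Fin 3) ℂ) (hA : A = KreinRange.T3 a b₁ b₂ c₁ c₂)
    (ℓ : ℝ)
    (hℓ : ℓ = Real.sqrt
      (2 * ‖Δ‖ - 2 * a ^ 2 + ‖b₁‖ ^ 2 + ‖b₂‖ ^ 2 + ‖c₁‖ ^ 2 + ‖c₂‖ ^ 2)) :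
    ((∃ H : KreinRange.Hyperbola,
        KreinRange.IsHyperbolicDisc (KreinRange.numRange KreinRange.J3 A) H δ ℓ) ↔
      (a ^ 2 - 2 * ‖Δ‖ < (Matrix.trace (KreinRange.adj KreinRange.J3 A * A)).re ∧
        (Matrix.trace (KreinRange.adj KreinRange.J3 A * A)).re < a ^ 2 + 2 * ‖Δ‖)) ∧
    (∀ H : KreinRange.Hyperbola,
      KreinRange.IsHyperbolicDisc (KreinRange.numRange KreinRange.J3 A) H δ ℓ →
        KreinRange.boundaryCurve KreinRange.J3 A = H.curve ∪ {(a : ℂ)}) := by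
  subst hδ hA hℓ
  obtain ⟨m, hm⟩ : ∃ m, m = 2 * a ^ 2 - (‖b₁‖ ^ 2 + ‖b₂‖ ^ 2 + ‖c₁‖ ^ 2 + ‖c₂‖ ^ 2) := ⟨_, rfl⟩
  have hs : 2 * ‖δ ^ 2‖ - 2 * a ^ 2 + ‖b₁‖ ^ 2 + ‖b₂‖ ^ 2 + ‖c₁‖ ^ 2 + ‖c₂‖ ^ 2
      = 2 * ‖δ ^ 2‖ - m := by rw [hm]; ring
  rw [KreinRange.trace_adj_T3, hs]
  have key : ∀ H : KreinRange.Hyperbola,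
      KreinRange.IsHyperbolicDisc (KreinRange.numRange KreinRange.J3
        (KreinRange.T3 a b₁ b₂ c₁ c₂)) H δ (√(2 * ‖δ ^ 2‖ - m)) →
      |m| < 2 * ‖δ ^ 2‖ ∧ (2 * H.semi) ^ 2 = m + 2 * ‖δ ^ 2‖ := by
    rintro H ⟨-, h₁, h₂, h⟩
    obtain ⟨hpos, hsemi⟩ := H.two_mul_semi_sq h₁ h₂ h
    have := H.semi_pos
    have : 0 < (2 * H.semi) ^ 2 := by positivity
    exact ⟨abs_lt.2 ⟨by linarith, by linarith⟩, by linarith⟩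
  refine ⟨⟨?_, ?_⟩, fun H hH => ?_⟩
  · rintro ⟨H, hH⟩
    have := abs_lt.1 (key H hH).1
    constructor <;> linarith
  · rintro ⟨h1, h2⟩
    have hmδ : |m| < 2 * ‖δ ^ 2‖ := abs_lt.2 ⟨by linarith, by linarith⟩
    obtain ⟨H, h₁, h₂, h⟩ := KreinRange.exists_hyperbola (δ := δ) (s := 2 * ‖δ ^ 2‖ - m)
      (by linarith) (by linarith)
    exact ⟨H, KreinRange.numRange_T3_eq_disc hm hΔ hmδ h₁ h₂
      (by linarith [(H.two_mul_semi_sq h₁ h₂ h).2]), h₁, h₂, h⟩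
  · obtain ⟨hmδ, hsemi⟩ := key H hH
    rw [KreinRange.boundaryCurve_T3 hm hΔ hmδ]
    congr 1
    ext z
    exact (KreinRange.mem_curve_iff hH.2.1 hH.2.2.1 hmδ hsemi z).symm
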